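/- Let $\mathcal H=\bigotimes_{k=1}^N\mathcal H_k$ be a tensor product of $N$ finite-dimensional complex Hilbert spaces, let $G_k$ be an arbitrary (not necessarily Hermitian) linear operator on $\mathcal H_k$ for each $k$, and let $$G=\sum_{k=1}^N G_k\otimes\bigotimes_{\ell\neq k}I_\ell ,$$ where $I_\ell$ is the identity on $\mathcal H_\ell$. Let $\rho$ be any density matrix on $\mathcal H$ (a positive semidefinite operator of trace one). For each $k$ let $\rho_k$ be the reduced density matrix on $\mathcal H_k$, obtained from $\rho$ by tracing out all $\mathcal H_\ell$ with $\ell\ne k$, and let $s_k=-\operatorname{Tr}[\rho_k\ln\rho_k]$ be its von Neumann entropy (natural logarithm, $0\ln 0=0$). Write $\|G_k\|_\infty$ for the Schatten $\infty$-norm of $G_k$, i.e. the largest eigenvalue of $\sqrt{G_k^\dagger G_k}$, and $\operatorname{Avg}_k(x_k)=\frac1N\sum_{k=1}^N x_k$. Then $$\operatorname{Var}(G)\;:=\;\operatorname{Tr}[\rho\, G^\dagger G]-\bigl|\operatorname{Tr}[\rho\, G]\bigr|^2\;\le\;\operatorname{Avg}_k\bigl(\|G_k\|_\infty^2\bigr)\Bigl(N+2N^2\sqrt{\operatorname{Avg}_k(s_k)}\Bigr).$$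 -/

import Mathlib

open scoped Matrix ComplexOrder

noncomputable section

namespace QuantumVariance

/-- A density matrix: positive semidefinite (in particular Hermitian) with trace one. -/
def IsDensityMatrix {n : Type*} [Fintype n] (ρ : Matrix n n ℂ) : Prop :=
  ρ.PosSemidef ∧ ρ.trace = 1

/-- The Schatten `∞`-norm: the operator norm of `M` acting on the Hilbert space `ℂⁿ` with its
Euclidean inner product, that is, the largest singular value of `M`. -/
def schattenInfNorm {n : Type*} [Fintype n] [DecidableEq n] (M : Matrix n n ℂ) : ℝ :=
  ‖Matrix.toEuclideanCLM (n := n) (𝕜 := ℂ) M‖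

/-- The von Neumann entropy `-Tr[ρ ln ρ]` of a Hermitian matrix, with `ln ρ` given by functional
calculus. The value of `Real.log` at `0` is immaterial because of the factor `ρ`. -/
def vonNeumannEntropy {n : Type*} [Fintype n] [DecidableEq n] (ρ : Matrix n n ℂ) : ℝ :=
  -((ρ * cfc Real.log ρ).trace).re

/-- The variance `Tr[ρ G†G] - |Tr[ρ G]|²` of a not necessarily Hermitian `G`. The first trace
is a real number, see `trace_mul_conjTranspose_mul_im`. -/
def variance {n : Type*} [Fintype n] (ρ G : Matrix n n ℂ) : ℝ :=
  ((ρ * (Gᴴ * G)).trace).re - ‖(ρ * G).trace‖ ^ 2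

theorem trace_mul_conjTranspose_mul_im {n : Type*} [Fintype n] {ρ : Matrix n n ℂ}
    (hρ : IsDensityMatrix ρ) (G : Matrix n n ℂ) : ((ρ * (Gᴴ * G)).trace).im = 0 := by
  have h : (ρ * (Gᴴ * G)).trace = (G * ρ * Gᴴ).trace := by
    rw [← Matrix.mul_assoc, Matrix.trace_mul_comm, ← Matrix.mul_assoc]
  rw [h]
  exact (Complex.nonneg_iff.mp (hρ.1.mul_mul_conjTranspose_same G).trace_nonneg).2.symm

section Sites

variable {N : ℕ} {d : Fin N → Type*} [∀ k, Fintype (d k)] [∀ k, DecidableEq (d k)]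

/-- The tensor product `⨂ₖ Aₖ` of operators `Aₖ` on `ℂ^{d k}`, as an operator on
`⨂ₖ ℂ^{d k} = ℂ^{∏ₖ d k}`, in the product basis `|x⟩ = ⨂ₖ |xₖ⟩`. -/
def tensorOp (A : ∀ k, Matrix (d k) (d k) ℂ) : Matrix (∀ k, d k) (∀ k, d k) ℂ :=
  Matrix.of fun x y => ∏ k, A k (x k) (y k)

/-- `A ⊗ ⨂_{ℓ ≠ k} I_ℓ`, the operator `A` acting on site `k`. -/
def siteOp (k : Fin N) (A : Matrix (d k) (d k) ℂ) : Matrix (∀ k, d k) (∀ k, d k) ℂ :=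
  tensorOp (Function.update (fun l => (1 : Matrix (d l) (d l) ℂ)) k A)

/-- The sum `∑ₖ Gₖ ⊗ ⨂_{ℓ ≠ k} I_ℓ` of single-site operators. -/
def sumSiteOp (G : ∀ k, Matrix (d k) (d k) ℂ) : Matrix (∀ k, d k) (∀ k, d k) ℂ :=
  ∑ k, siteOp k (G k)

/-- The reduced matrix on site `k`, obtained by tracing out all other sites. A configuration is
split as a pair of its value at `k` and its values `z` at the sites other than `k`. -/
def reduced (k : Fin N) (ρ : Matrix (∀ k, d k) (∀ k, d k) ℂ) : Matrix (d k) (d k) ℂ :=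
  Matrix.of fun a b => ∑ z : (∀ l : {l // l ≠ k}, d l),
    ρ ((Equiv.piSplitAt k d).symm (a, z)) ((Equiv.piSplitAt k d).symm (b, z))

end Sites

/-- The average of `f k` over the `N` sites. -/
def avg {N : ℕ} (f : Fin N → ℝ) : ℝ := (∑ k, f k) / N

end QuantumVariance

end

/-! The variance is the sum of the covariances of `(G k)ᴴ` and `G l` over all pairs of sites. Each
diagonal term is at most `‖G k‖ ^ 2`. For `k ≠ l` a covariance is small when site `k` is nearly
pure: a pure site factors out of the state and is uncorrelated with the rest.

Quantitatively (`norm_covariance_siteOp_le`), let `P` project onto a top eigenvector of the reduced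
state, with eigenvalue `1 - ε`. Being rank one, `P` compresses every site operator to a scalar;
commuting with the reduced state, it removes the off-diagonal expectations. What is left of the
covariance is of order `√ε`. The minimum of this bound and the trivial bound `‖A‖ * ‖B‖` is
controlled by `√s`, a scalar inequality about entropy (`min_one_le_two_mul_sqrt_entropy`).
Cauchy–Schwarz over the sites then produces the averages. -/

namespace QuantumVariance

/-! ### Expectations and covariances in a fixed state. -/

section Functional

open scoped Matrix.Norms.L2Operator MatrixOrder

variable {n : Type*} [Fintype n]

/-- Cauchy–Schwarz for the semi-inner product `Tr[ρ Xᴴ Y]`. -/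
theorem norm_trace_mul_conjTranspose_mul_sq_le {ρ : Matrix n n ℂ} (hρ : ρ.PosSemidef)
    (X Y : Matrix n n ℂ) :
    ‖(ρ * (Xᴴ * Y)).trace‖ ^ 2 ≤
      ((ρ * (Xᴴ * X)).trace).re * ((ρ * (Yᴴ * Y)).trace).re := by
  have key : ∀ U V : Matrix n n ℂ, (V * ρ * Uᴴ).trace = (ρ * (Uᴴ * V)).trace := fun U V => by
    rw [Matrix.trace_mul_comm, ← Matrix.mul_assoc, Matrix.trace_mul_comm]
  let i1 : SeminormedAddCommGroup (Matrix n n ℂ) := ρ.toMatrixSeminormedAddCommGroup hρ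
  let i2 : InnerProductSpace ℂ (Matrix n n ℂ) := ρ.toMatrixInnerProductSpace hρ
  have h := inner_mul_inner_self_le (𝕜 := ℂ) X Y
  have e : ∀ U V : Matrix n n ℂ, inner ℂ U V = (ρ * (Uᴴ * V)).trace := fun U V => key U V
  rw [norm_inner_symm Y X, e, e, e, ← sq] at h
  exact h

theorem trace_mul_conjTranspose_mul_self_nonneg {ρ : Matrix n n ℂ} (hρ : ρ.PosSemidef)
    (X : Matrix n n ℂ) : 0 ≤ ((ρ * (Xᴴ * X)).trace).re := by
  have h : (ρ * (Xᴴ * X)).trace = (X * ρ * Xᴴ).trace := by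
    rw [← Matrix.mul_assoc, Matrix.trace_mul_comm, ← Matrix.mul_assoc]
  rw [h]
  exact (Complex.nonneg_iff.mp (hρ.mul_mul_conjTranspose_same X).trace_nonneg).1

theorem trace_star_apply {ρ : Matrix n n ℂ} (hρ : ρ.IsHermitian) (X : Matrix n n ℂ) :
    (ρ * Xᴴ).trace = star (ρ * X).trace := by
  rw [← Matrix.trace_conjTranspose, Matrix.conjTranspose_mul, hρ.eq, Matrix.trace_mul_comm]

variable [DecidableEq n]

theorem trace_mul_mono {ρ : Matrix n n ℂ} (hρ : ρ.PosSemidef) {X Y : Matrix n n ℂ}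
    (h : X ≤ Y) : ((ρ * X).trace).re ≤ ((ρ * Y).trace).re := by
  obtain ⟨C, hC⟩ := CStarAlgebra.nonneg_iff_eq_star_mul_self.mp (sub_nonneg.mpr h)
  have h1 := trace_mul_conjTranspose_mul_self_nonneg hρ C
  rw [← Matrix.star_eq_conjTranspose, ← hC, Matrix.mul_sub, Matrix.trace_sub, Complex.sub_re] at h1
  linarith

theorem trace_conj_norm_sq_le {ρ : Matrix n n ℂ} (hρ : ρ.PosSemidef) (A X : Matrix n n ℂ) :
    ((ρ * ((A * X)ᴴ * (A * X))).trace).re ≤ ‖A‖ ^ 2 * ((ρ * (Xᴴ * X)).trace).re := by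
  have h1 : star X * (star A * A) * X ≤ ‖star A * A‖ • (star X * X) :=
    CStarAlgebra.star_left_conjugate_le_norm_smul (IsSelfAdjoint.star_mul_self A)
  have h2 := trace_mul_mono hρ h1
  rw [CStarRing.norm_star_mul_self, ← sq] at h2
  have e : (A * X)ᴴ * (A * X) = star X * (star A * A) * X := by
    simp only [Matrix.conjTranspose_mul, Matrix.star_eq_conjTranspose, Matrix.mul_assoc]
  rw [e]
  refine h2.trans (le_of_eq ?_)
  rw [Matrix.mul_smul, Matrix.trace_smul, Complex.smul_re, smul_eq_mul]
  rfl

theorem norm_trace_sandwich_le {ρ : Matrix n n ℂ} (hρ : ρ.PosSemidef) (A X Y : Matrix n n ℂ) :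
    ‖(ρ * (Xᴴ * A * Y)).trace‖ ≤
      ‖A‖ * (√((ρ * (Xᴴ * X)).trace).re * √((ρ * (Yᴴ * Y)).trace).re) := by
  have h1 := norm_trace_mul_conjTranspose_mul_sq_le hρ X (A * Y)
  have h2 := trace_conj_norm_sq_le hρ A Y
  have hX := trace_mul_conjTranspose_mul_self_nonneg hρ X
  have hY := trace_mul_conjTranspose_mul_self_nonneg hρ Y
  rw [Matrix.mul_assoc]
  refine abs_le_of_sq_le_sq' ?_ (by positivity) |>.2
  rw [mul_pow, mul_pow, Real.sq_sqrt hX, Real.sq_sqrt hY]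
  nlinarith [mul_le_mul_of_nonneg_left h2 hX]

theorem trace_norm_sq_le {ρ : Matrix n n ℂ} (hρ : IsDensityMatrix ρ) (A : Matrix n n ℂ) :
    ((ρ * (Aᴴ * A)).trace).re ≤ ‖A‖ ^ 2 := by
  have := trace_conj_norm_sq_le hρ.1 A 1
  simpa [hρ.2] using this

theorem norm_trace_le {ρ : Matrix n n ℂ} (hρ : IsDensityMatrix ρ) (A : Matrix n n ℂ) :
    ‖(ρ * A).trace‖ ≤ ‖A‖ := by
  have := norm_trace_sandwich_le hρ.1 A 1 1
  simpa [hρ.2] using this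

/-- The covariance `Tr[ρ A B] - Tr[ρ A] Tr[ρ B]`. -/
def covariance (ρ A B : Matrix n n ℂ) : ℂ :=
  (ρ * (A * B)).trace - (ρ * A).trace * (ρ * B).trace

theorem centered_second_moment_le {ρ : Matrix n n ℂ} (hρ : IsDensityMatrix ρ)
    (A : Matrix n n ℂ) :
    ((ρ * ((A - (ρ * A).trace • 1)ᴴ * (A - (ρ * A).trace • 1))).trace).re ≤ ‖A‖ ^ 2 := by
  refine le_trans (le_of_eq ?_) ((sub_le_self _ (sq_nonneg ‖(ρ * A).trace‖)).trans
    (trace_norm_sq_le hρ A))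
  have h1 := trace_star_apply hρ.1.isHermitian A
  have h2 : (ρ * ((A - (ρ * A).trace • 1)ᴴ * (A - (ρ * A).trace • 1))).trace =
      (ρ * (Aᴴ * A)).trace - star (ρ * A).trace * (ρ * A).trace := by
    simp only [Matrix.conjTranspose_sub, Matrix.conjTranspose_smul, Matrix.conjTranspose_one,
      sub_mul, mul_sub, Matrix.trace_sub, Matrix.smul_mul, Matrix.mul_smul, Matrix.trace_smul,
      Matrix.mul_one, Matrix.one_mul, h1, hρ.2, smul_eq_mul]
    ring
  have h3 : star (ρ * A).trace * (ρ * A).trace = ((‖(ρ * A).trace‖ ^ 2 : ℝ) : ℂ) := by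
    rw [Complex.star_def, Complex.conj_mul', Complex.ofReal_pow]
  rw [h2, h3, Complex.sub_re, Complex.ofReal_re]

theorem norm_covariance_le_mul {ρ : Matrix n n ℂ} (hρ : IsDensityMatrix ρ)
    (A B : Matrix n n ℂ) : ‖covariance ρ A B‖ ≤ ‖A‖ * ‖B‖ := by
  have h1 := trace_star_apply hρ.1.isHermitian A
  -- The covariance is bilinear, without conjugation, so Cauchy–Schwarz is applied to the centered
  -- `Aᴴ` and `B`.
  have e : covariance ρ A B =
      (ρ * ((Aᴴ - (ρ * Aᴴ).trace • 1)ᴴ * (B - (ρ * B).trace • 1))).trace := by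
    simp only [covariance, Matrix.conjTranspose_sub, Matrix.conjTranspose_smul,
      Matrix.conjTranspose_one, Matrix.conjTranspose_conjTranspose,
      sub_mul, mul_sub, Matrix.trace_sub, Matrix.smul_mul, Matrix.mul_smul, Matrix.trace_smul,
      Matrix.mul_one, Matrix.one_mul, h1, star_star, hρ.2, smul_eq_mul]
    ring
  have h2 := norm_trace_mul_conjTranspose_mul_sq_le hρ.1
    (Aᴴ - (ρ * Aᴴ).trace • 1) (B - (ρ * B).trace • 1)
  rw [← e] at h2
  have hA := centered_second_moment_le hρ Aᴴ
  have hB := centered_second_moment_le hρ B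
  rw [Matrix.l2_opNorm_conjTranspose] at hA
  refine abs_le_of_sq_le_sq' (h2.trans ?_) (by positivity) |>.2
  rw [mul_pow]
  exact mul_le_mul hA hB (trace_mul_conjTranspose_mul_self_nonneg hρ.1 _) (by positivity)

/-- If `P` commutes with `B`, compresses `A` to a scalar and does not see the off-diagonal blocks
of `A` under `ρ`, then `A` and `B` are nearly uncorrelated as soon as `Tr[ρ P]` is close to `1`. -/
theorem norm_covariance_le_of_projection {ρ : Matrix n n ℂ} (hρ : IsDensityMatrix ρ)
    {A B P : Matrix n n ℂ} {α : ℂ} {a ε : ℝ} (hP : P * P = P) (hPs : Pᴴ = P)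
    (hPB : P * B = B * P) (hα : P * A * P = α • P) (hA : ‖A‖ ≤ a) (hαn : ‖α‖ ≤ a)
    (h₁ : (ρ * (P * A * (1 - P))).trace = 0) (h₂ : (ρ * ((1 - P) * A * P)).trace = 0)
    (hε : ((ρ * P).trace).re = 1 - ε) :
    ‖covariance ρ A B‖ ≤ a * ‖B‖ * (2 * √(ε * (1 - ε)) + 4 * ε) := by
  set Q : Matrix n n ℂ := 1 - P with hQ
  have hQs : Qᴴ = Q := by rw [hQ, Matrix.conjTranspose_sub, hPs, Matrix.conjTranspose_one]
  have hQQ : Q * Q = Q := by rw [hQ]; simp [mul_sub, sub_mul, hP]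
  have hQB : Q * B = B * Q := by rw [hQ, sub_mul, mul_sub, hPB, one_mul, mul_one]
  have hPQ : P + Q = 1 := by rw [hQ]; abel
  have tP : ((ρ * (Pᴴ * P)).trace).re = 1 - ε := by rw [hPs, hP, hε]
  have tQ : ((ρ * (Qᴴ * Q)).trace).re = ε := by
    rw [hQs, hQQ, hQ, mul_sub, Matrix.trace_sub, mul_one, hρ.2, Complex.sub_re, hε,
      Complex.one_re]
    ring
  have ha : 0 ≤ a := (norm_nonneg A).trans hA
  have hABn : ‖A * B‖ ≤ a * ‖B‖ :=
    (norm_mul_le _ _).trans (mul_le_mul_of_nonneg_right hA (norm_nonneg B))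
  have hε0 : 0 ≤ ε := tQ ▸ trace_mul_conjTranspose_mul_self_nonneg hρ.1 Q
  have hε1 : 0 ≤ 1 - ε := tP ▸ trace_mul_conjTranspose_mul_self_nonneg hρ.1 P
  have split : ∀ X : Matrix n n ℂ, X = P * X * P + P * X * Q + Q * X * P + Q * X * Q := by
    intro X
    calc X = (P + Q) * X * (P + Q) := by rw [hPQ, one_mul, mul_one]
      _ = _ := by noncomm_ring
  -- Writing `P B P` as `B - Q B Q` isolates `α Tr[ρ B]`, which cancels against the leading part of
  -- `Tr[ρ A] Tr[ρ B]`.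
  have hPABP : P * (A * B) * P = α • B - α • (Q * B * Q) := by
    have e1 : P * (A * B) * P = P * A * P * B := by
      simp only [mul_assoc, hPB]
    have e2 : Q * B * Q = Q * B := by rw [mul_assoc, ← hQB, ← mul_assoc, hQQ]
    rw [e1, hα, e2, ← smul_sub, smul_mul_assoc, hQ, sub_mul, one_mul, sub_sub_cancel]
  have wA : (ρ * A).trace = α - α * (ρ * Q).trace + (ρ * (Q * A * Q)).trace := by
    conv_lhs => rw [split A]
    have e3 : (ρ * P).trace = 1 - (ρ * Q).trace := by
      rw [hQ, mul_sub, Matrix.trace_sub, mul_one, hρ.2, sub_sub_cancel]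
    simp only [mul_add, Matrix.trace_add, h₁, h₂, hα, Matrix.mul_smul, Matrix.trace_smul,
      smul_eq_mul, e3]
    ring
  have wAB : (ρ * (A * B)).trace = α * (ρ * B).trace - α * (ρ * (Q * B * Q)).trace
      + (ρ * (P * (A * B) * Q)).trace + (ρ * (Q * (A * B) * P)).trace
      + (ρ * (Q * (A * B) * Q)).trace := by
    conv_lhs => rw [split (A * B)]
    rw [hPABP]
    simp only [mul_add, mul_sub, Matrix.trace_add, Matrix.trace_sub, Matrix.mul_smul,
      Matrix.trace_smul, smul_eq_mul]
  -- The two off-diagonal blocks of `A * B` need not vanish; they give the square roots. The four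
  -- remaining errors are each of order `ε`.
  have n1 : ‖(ρ * (P * (A * B) * Q)).trace‖ ≤ a * ‖B‖ * √(ε * (1 - ε)) := by
    have := norm_trace_sandwich_le hρ.1 (A * B) P Q
    rw [tP, tQ, hPs, mul_comm √(1 - ε), ← Real.sqrt_mul hε0] at this
    exact this.trans (mul_le_mul_of_nonneg_right hABn (Real.sqrt_nonneg _))
  have n2 : ‖(ρ * (Q * (A * B) * P)).trace‖ ≤ a * ‖B‖ * √(ε * (1 - ε)) := by
    have := norm_trace_sandwich_le hρ.1 (A * B) Q P
    rw [tP, tQ, hQs, ← Real.sqrt_mul hε0] at this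
    exact this.trans (mul_le_mul_of_nonneg_right hABn (Real.sqrt_nonneg _))
  have nQ : ∀ X : Matrix n n ℂ, ‖(ρ * (Q * X * Q)).trace‖ ≤ ‖X‖ * ε := by
    intro X
    have := norm_trace_sandwich_le hρ.1 X Q Q
    rwa [tQ, hQs, Real.mul_self_sqrt hε0] at this
  have n3 : ‖(ρ * (Q * (A * B) * Q)).trace‖ ≤ a * ‖B‖ * ε :=
    (nQ _).trans (mul_le_mul_of_nonneg_right hABn hε0)
  have n4 : ‖α * (ρ * (Q * B * Q)).trace‖ ≤ a * ‖B‖ * ε := by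
    rw [norm_mul]
    exact (mul_le_mul hαn (nQ B) (norm_nonneg _) ha).trans_eq (by ring)
  have nQ1 : ‖(ρ * Q).trace‖ ≤ ε := by
    have := norm_trace_mul_conjTranspose_mul_sq_le hρ.1 Q Q
    rw [tQ, hQs, hQQ, ← sq] at this
    exact abs_le_of_sq_le_sq' this hε0 |>.2
  have nB := norm_trace_le hρ B
  have n5 : ‖(ρ * (Q * A * Q)).trace * (ρ * B).trace‖ ≤ a * ‖B‖ * ε := by
    rw [norm_mul]
    refine (mul_le_mul ((nQ A).trans (mul_le_mul_of_nonneg_right hA hε0)) nB (norm_nonneg _) (by positivity)).trans (le_of_eq (by ring))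
  have n6 : ‖α * (ρ * Q).trace * (ρ * B).trace‖ ≤ a * ‖B‖ * ε := by
    rw [norm_mul, norm_mul]
    refine (mul_le_mul (mul_le_mul hαn nQ1 (norm_nonneg _) ha) nB (norm_nonneg _)
      (by positivity)).trans (le_of_eq (by ring))
  have e : covariance ρ A B = (ρ * (P * (A * B) * Q)).trace + (ρ * (Q * (A * B) * P)).trace
      + (ρ * (Q * (A * B) * Q)).trace - α * (ρ * (Q * B * Q)).trace
      - (ρ * (Q * A * Q)).trace * (ρ * B).trace + α * (ρ * Q).trace * (ρ * B).trace := by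
    rw [covariance, wAB, wA]; ring
  rw [e]
  refine (norm_add_le _ _).trans ?_
  refine (add_le_add_left (norm_sub_le _ _) _).trans ?_
  refine (add_le_add_left (add_le_add_left (norm_sub_le _ _) _) _).trans ?_
  refine (add_le_add_left (add_le_add_left (add_le_add_left (norm_add₃_le) _) _) _).trans ?_
  linarith

end Functional

/-! ### Entropy controls the distance of the top eigenvalue from one. -/

section Entropy

open scoped Matrix.Norms.L2Operator MatrixOrder

/-- With `p i = 1 - ε`, the entropy is at least `ε`, and at least `ε (-log ε) + ε (1 - ε)`, because
every other weight is at most `ε`. Once the entropy reaches `1/4` the constant `1` suffices; this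
covers `ε ≥ 1/8`. For smaller `ε` the logarithm absorbs the linear term. -/
theorem min_one_le_two_mul_sqrt_entropy {n : Type*} [Fintype n] {p : n → ℝ}
    (h0 : ∀ j, 0 ≤ p j) (h1 : ∑ j, p j = 1) (i : n) (hi : ∀ j, p j ≤ p i) :
    min 1 (2 * √((1 - p i) * p i) + 4 * (1 - p i)) ≤ 2 * √(∑ j, Real.negMulLog (p j)) := by
  classical
  obtain ⟨ε, hε⟩ : ∃ ε, p i = 1 - ε := ⟨1 - p i, by ring⟩
  have hle1 : ∀ j, p j ≤ 1 := fun j =>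
    h1 ▸ Finset.single_le_sum (fun k _ => h0 k) (Finset.mem_univ j)
  have lin : ∀ j, p j * (1 - p j) ≤ Real.negMulLog (p j) := fun j => by
    rcases (h0 j).eq_or_lt with h | h
    · simp [← h]
    · rw [Real.negMulLog]
      nlinarith [Real.log_le_sub_one_of_pos h]
  have sε : ε ≤ ∑ j, Real.negMulLog (p j) := by
    calc ε = ∑ j, p j * ε := by rw [← Finset.sum_mul, h1, one_mul]
      _ ≤ _ := Finset.sum_le_sum fun j _ => le_trans
        (mul_le_mul_of_nonneg_left (by linarith [hi j]) (h0 j)) (lin j)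
  have hε0 : 0 ≤ ε := by linarith [hle1 i]
  have sum_erase : ∑ j ∈ Finset.univ.erase i, p j = ε := by
    have := Finset.add_sum_erase Finset.univ p (Finset.mem_univ i)
    linarith
  have slog : ε * (-Real.log ε) + ε * (1 - ε) ≤ ∑ j, Real.negMulLog (p j) := by
    rw [← Finset.add_sum_erase Finset.univ _ (Finset.mem_univ i), add_comm]
    refine add_le_add (by have := lin i; rw [hε] at this ⊢; linarith) ?_
    calc ε * (-Real.log ε) = ∑ j ∈ Finset.univ.erase i, p j * (-Real.log ε) := by
          rw [← Finset.sum_mul, sum_erase]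
      _ ≤ _ := Finset.sum_le_sum fun j hj => by
        have hjε : p j ≤ ε := sum_erase ▸ Finset.single_le_sum (fun k _ => h0 k) hj
        rcases (h0 j).eq_or_lt with h | h
        · simp [← h]
        · rw [Real.negMulLog]
          nlinarith [Real.log_le_log h hjε]
  set s := ∑ j, Real.negMulLog (p j)
  rw [hε, sub_sub_cancel]
  have quarter : 1 / 4 ≤ s → min 1 (2 * √(ε * (1 - ε)) + 4 * ε) ≤ 2 * √s := fun h => by
    refine (min_le_left _ _).trans ?_
    have : (1 / 2 : ℝ) ≤ √s := Real.le_sqrt_of_sq_le (by linarith)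
    linarith
  rcases le_or_gt (1 / 4) ε with h4 | h4
  · exact quarter (h4.trans sε)
  rcases hε0.eq_or_lt with h | hpos
  · rw [← h]; simp
  have l2 := Real.log_two_gt_d9
  rcases le_or_gt (1 / 8) ε with h8 | h8
  · refine quarter ?_
    have : Real.log ε ≤ -(2 * Real.log 2) := by
      calc Real.log ε ≤ Real.log ((2 ^ 2)⁻¹) := Real.log_le_log hpos (by norm_num; linarith)
        _ = _ := by rw [Real.log_inv, Real.log_pow]; norm_num
    nlinarith
  -- With `r = √(ε (1 - ε))`, squaring `r + 2 ε` and cancelling `ε (1 - ε)` leaves `4 r + 4 ε ≤ -log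
  -- ε`. Here `r ≤ 1/3` and `ε < 1/8` make the left side less than `3 log 2`.
  · refine (min_le_right _ _).trans ?_
    have hl : Real.log ε ≤ -(3 * Real.log 2) := by
      calc Real.log ε ≤ Real.log ((2 ^ 3)⁻¹) := Real.log_le_log hpos (by norm_num; linarith)
        _ = _ := by rw [Real.log_inv, Real.log_pow]; norm_num
    have hm : 0 ≤ ε * (1 - ε) := mul_nonneg hε0 (by linarith)
    have hr2 := Real.sq_sqrt hm
    have hr : √(ε * (1 - ε)) ≤ 1 / 3 := Real.sqrt_le_iff.mpr ⟨by norm_num, by nlinarith⟩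
    have hr0 := Real.sqrt_nonneg (ε * (1 - ε))
    have : √(ε * (1 - ε)) + 2 * ε ≤ √s := by
      refine Real.le_sqrt_of_sq_le (le_trans ?_ slog)
      nlinarith [mul_le_mul_of_nonneg_left hr hε0]
    linarith

variable {n : Type*} [Fintype n] [DecidableEq n]

theorem vonNeumannEntropy_eq_sum {ρ : Matrix n n ℂ} (hρ : ρ.IsHermitian) :
    vonNeumannEntropy ρ = ∑ j, Real.negMulLog (hρ.eigenvalues j) := by
  have h : (ρ * cfc Real.log ρ).trace =
      ∑ j, ((hρ.eigenvalues j * Real.log (hρ.eigenvalues j) : ℝ) : ℂ) := by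
    have e := hρ.spectral_theorem
    rw [hρ.cfc_eq, Matrix.IsHermitian.cfc]
    conv_lhs => enter [1, 1]; rw [e]
    rw [← map_mul, Unitary.conjStarAlgAut_apply, Matrix.trace_mul_comm, ← mul_assoc,
      Unitary.coe_star_mul_self, one_mul, Matrix.diagonal_mul_diagonal, Matrix.trace_diagonal]
    simp
  rw [vonNeumannEntropy, h, ← Complex.ofReal_sum, Complex.ofReal_re, ← Finset.sum_neg_distrib]
  exact Finset.sum_congr rfl fun j _ => by rw [Real.negMulLog]; ring

/-- The rank-one spectral projection of a density matrix for its largest eigenvalue. -/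
theorem exists_top_projection {ρ : Matrix n n ℂ} (hρ : IsDensityMatrix ρ) :
    ∃ (P : Matrix n n ℂ) (ε : ℝ), P * P = P ∧ Pᴴ = P ∧ P * ρ = ρ * P ∧
      (∀ A : Matrix n n ℂ, ∃ α : ℂ, P * A * P = α • P ∧ ‖α‖ ≤ ‖A‖) ∧
      ((ρ * P).trace).re = 1 - ε ∧
      min 1 (2 * √(ε * (1 - ε)) + 4 * ε) ≤ 2 * √(vonNeumannEntropy ρ) := by
  have hH := hρ.1.isHermitian
  have : Nonempty n := by
    by_contra h
    rw [not_nonempty_iff] at h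
    simpa [Matrix.trace] using hρ.2
  obtain ⟨i, -, hi⟩ := Finset.exists_max_image Finset.univ hH.eigenvalues Finset.univ_nonempty
  have hsum : ∑ j, hH.eigenvalues j = 1 := by
    have := hH.trace_eq_sum_eigenvalues
    rw [hρ.2] at this
    exact Complex.ofReal_injective (by rw [Complex.ofReal_sum, Complex.ofReal_one]; exact this.symm)
  set φ := Unitary.conjStarAlgAut ℂ (Matrix n n ℂ) hH.eigenvectorUnitary with hφ
  have hspec : ρ = φ (Matrix.diagonal (RCLike.ofReal ∘ hH.eigenvalues)) := hH.spectral_theorem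
  -- The projection is built in the eigenbasis, where the state is diagonal, and carried back by the
  -- automorphism `φ`.
  set E : Matrix n n ℂ := Matrix.single i i 1 with hE
  have hEE : E * E = E := by simp [hE]
  have hEs : star E = E := by simp [hE, Matrix.star_eq_conjTranspose]
  have hPP : φ E * φ E = φ E := by rw [← map_mul, hEE]
  have hPs : star (φ E) = φ E := by rw [← map_star, hEs]
  have hρP : ρ * φ E = (hH.eigenvalues i : ℂ) • φ E := by
    conv_lhs => rw [hspec, ← map_mul]
    rw [← map_smul]
    congr 1
    ext a b
    by_cases h : i = a <;> simp [hE, Matrix.diagonal_mul, Matrix.single_apply, h]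
  have hPρ : φ E * ρ = (hH.eigenvalues i : ℂ) • φ E := by
    conv_lhs => enter [2]; rw [hspec]
    rw [← map_mul, ← map_smul]
    congr 1
    ext a b
    by_cases h : i = b <;> simp [hE, Matrix.mul_diagonal, Matrix.single_apply, h]
  have htr : (φ E).trace = 1 := by
    rw [hφ, Unitary.conjStarAlgAut_apply, Matrix.trace_mul_comm, ← mul_assoc,
      Unitary.coe_star_mul_self, one_mul, hE, Matrix.trace_single_eq_same]
  have hP0 : φ E ≠ 0 := fun h => by simp [h] at htr
  have hPn : ‖φ E‖ = 1 := by
    have h := CStarRing.norm_star_mul_self (x := φ E)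
    rw [hPs, hPP] at h
    have h0 : ‖φ E‖ ≠ 0 := norm_ne_zero_iff.mpr hP0
    exact (mul_eq_left₀ h0).mp h.symm
  refine ⟨φ E, 1 - hH.eigenvalues i, hPP, hPs, hPρ.trans hρP.symm, fun A => ?_, ?_, ?_⟩
  · obtain ⟨A', rfl⟩ : ∃ A', φ A' = A := ⟨φ.symm A, φ.apply_symm_apply A⟩
    have hα : φ E * φ A' * φ E = A' i i • φ E := by
      rw [← map_mul, ← map_mul, ← map_smul]
      congr 1
      simp [hE]
    refine ⟨A' i i, hα, ?_⟩
    calc ‖A' i i‖ = ‖A' i i • φ E‖ := by rw [norm_smul, hPn, mul_one]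
      _ = ‖φ E * φ A' * φ E‖ := by rw [hα]
      _ ≤ ‖φ E‖ * ‖φ A'‖ * ‖φ E‖ := norm_mul₃_le
      _ = ‖φ A'‖ := by rw [hPn, one_mul, mul_one]
  · rw [hρP, Matrix.trace_smul, htr, smul_eq_mul, mul_one, Complex.ofReal_re]
    ring
  · have h := min_one_le_two_mul_sqrt_entropy (fun j => hρ.1.eigenvalues_nonneg j) hsum i
      (fun j => hi j (Finset.mem_univ j))
    rwa [← vonNeumannEntropy_eq_sum hH, show hH.eigenvalues i = 1 - (1 - hH.eigenvalues i) by ring,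
      sub_sub_cancel] at h

end Entropy

/-! ### Single-site operators, partial traces and correlations between sites. -/

section SiteOperators

open scoped Matrix.Norms.L2Operator MatrixOrder

theorem tensorOp_mul {N : ℕ} {d : Fin N → Type*} [∀ k, Fintype (d k)]
    (A B : ∀ k, Matrix (d k) (d k) ℂ) :
    tensorOp A * tensorOp B = tensorOp fun k => A k * B k := by
  ext x y
  simp only [tensorOp, Matrix.mul_apply, Matrix.of_apply, ← Finset.prod_mul_distrib]
  rw [Finset.prod_univ_sum, Fintype.piFinset_univ]

variable {N : ℕ} {d : Fin N → Type*} [∀ k, DecidableEq (d k)]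

theorem siteOp_apply (k : Fin N) (A : Matrix (d k) (d k) ℂ) (x y : ∀ l, d l) :
    siteOp k A x y = A (x k) (y k) *
      ∏ l ∈ Finset.univ.erase k, (1 : Matrix (d l) (d l) ℂ) (x l) (y l) := by
  rw [siteOp, tensorOp, Matrix.of_apply, ← Finset.mul_prod_erase _ _ (Finset.mem_univ k),
    Function.update_self]
  congr 1
  exact Finset.prod_congr rfl fun l hl => by rw [Function.update_of_ne (Finset.ne_of_mem_erase hl)]

theorem siteOp_one (k : Fin N) : siteOp k (1 : Matrix (d k) (d k) ℂ) = 1 := by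
  rw [siteOp, Function.update_eq_self_iff.mpr rfl]
  ext x y
  rw [tensorOp, Matrix.of_apply]
  rcases eq_or_ne x y with rfl | h
  · simp
  · obtain ⟨l, hl⟩ := Function.ne_iff.mp h
    rw [Matrix.one_apply_ne h]
    exact Finset.prod_eq_zero (Finset.mem_univ l) (Matrix.one_apply_ne hl)

theorem siteOp_conjTranspose (k : Fin N) (A : Matrix (d k) (d k) ℂ) :
    siteOp k Aᴴ = (siteOp k A)ᴴ := by
  ext x y
  simp only [siteOp_apply, Matrix.conjTranspose_apply, star_mul', star_prod]
  congr 1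
  refine Finset.prod_congr rfl fun l _ => ?_
  rw [← Matrix.conjTranspose_apply, Matrix.conjTranspose_one]

theorem siteOp_piSplitAt (k : Fin N) (A : Matrix (d k) (d k) ℂ) (a b : d k)
    (z w : ∀ l : {l // l ≠ k}, d l) :
    siteOp k A ((Equiv.piSplitAt k d).symm (a, z)) ((Equiv.piSplitAt k d).symm (b, w)) =
      if z = w then A a b else 0 := by
  rw [siteOp_apply]
  have hk : ∀ (c : d k) (u : ∀ l : {l // l ≠ k}, d l), (Equiv.piSplitAt k d).symm (c, u) k = c :=
    fun c u => by simp [Equiv.piSplitAt]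
  have hl : ∀ (c : d k) (u : ∀ l : {l // l ≠ k}, d l) (l : Fin N) (h : l ≠ k),
      (Equiv.piSplitAt k d).symm (c, u) l = u ⟨l, h⟩ := fun c u l h => by
    simp [Equiv.piSplitAt, h]
  rw [hk, hk]
  split_ifs with h
  · rw [Finset.prod_eq_one, mul_one]
    intro l hm
    rw [hl _ _ _ (Finset.ne_of_mem_erase hm), hl _ _ _ (Finset.ne_of_mem_erase hm), h,
      Matrix.one_apply_eq]
  · obtain ⟨⟨l, hlk⟩, hne⟩ := Function.ne_iff.mp h
    rw [Finset.prod_eq_zero (Finset.mem_erase.mpr ⟨hlk, Finset.mem_univ l⟩), mul_zero]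
    rw [hl _ _ _ hlk, hl _ _ _ hlk, Matrix.one_apply_ne hne]

variable [∀ k, Fintype (d k)]

theorem siteOp_mul (k : Fin N) (A B : Matrix (d k) (d k) ℂ) :
    siteOp k (A * B) = siteOp k A * siteOp k B := by
  rw [siteOp, siteOp, siteOp, tensorOp_mul]
  congr 1
  ext1 l
  rcases eq_or_ne l k with rfl | h
  · simp
  · simp [Function.update_of_ne h]

theorem siteOp_commute {k l : Fin N} (h : k ≠ l) (A : Matrix (d k) (d k) ℂ)
    (B : Matrix (d l) (d l) ℂ) : siteOp k A * siteOp l B = siteOp l B * siteOp k A := by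
  rw [siteOp, siteOp, tensorOp_mul, tensorOp_mul]
  congr 1
  ext1 m
  rcases eq_or_ne m k with rfl | hk
  · simp [Function.update_of_ne h]
  · simp [Function.update_of_ne hk]

/-- The action on one site as a `⋆`-homomorphism. -/
def siteHom (k : Fin N) : Matrix (d k) (d k) ℂ →⋆ₐ[ℂ] Matrix (∀ l, d l) (∀ l, d l) ℂ where
  toFun := siteOp k
  map_one' := siteOp_one k
  map_mul' := siteOp_mul k
  map_zero' := by ext x y; simp [siteOp_apply]
  map_add' A B := by ext x y; simp [siteOp_apply, add_mul]
  commutes' r := by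
    rw [Algebra.algebraMap_eq_smul_one, Algebra.algebraMap_eq_smul_one, ← siteOp_one k]
    ext x y
    simp [siteOp_apply, mul_assoc]
  map_star' A := siteOp_conjTranspose k A

/-- A star homomorphism of C⋆-algebras is contractive. -/
theorem norm_siteOp_le (k : Fin N) (A : Matrix (d k) (d k) ℂ) : ‖siteOp k A‖ ≤ ‖A‖ :=
  NonUnitalStarAlgHom.norm_apply_le (siteHom k) A

theorem trace_mul_siteOp (k : Fin N) (ρ : Matrix (∀ l, d l) (∀ l, d l) ℂ)
    (A : Matrix (d k) (d k) ℂ) : (ρ * siteOp k A).trace = (reduced k ρ * A).trace := by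
  simp only [Matrix.trace, Matrix.diag_apply, Matrix.mul_apply, reduced, Matrix.of_apply]
  rw [← (Equiv.piSplitAt k d).symm.sum_comp, Fintype.sum_prod_type]
  refine Finset.sum_congr rfl fun a _ => ?_
  simp_rw [Finset.sum_mul]
  rw [Finset.sum_comm (s := (Finset.univ : Finset (d k)))]
  refine Finset.sum_congr rfl fun z _ => ?_
  rw [← (Equiv.piSplitAt k d).symm.sum_comp, Fintype.sum_prod_type]
  refine Finset.sum_congr rfl fun b _ => ?_
  simp [siteOp_piSplitAt]

theorem isDensityMatrix_reduced (k : Fin N) {ρ : Matrix (∀ l, d l) (∀ l, d l) ℂ}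
    (hρ : IsDensityMatrix ρ) : IsDensityMatrix (reduced k ρ) := by
  constructor
  · have : reduced k ρ = ∑ z : (∀ l : {l // l ≠ k}, d l),
        ρ.submatrix (fun a => (Equiv.piSplitAt k d).symm (a, z))
          (fun a => (Equiv.piSplitAt k d).symm (a, z)) := by
      ext a b
      simp [reduced, Matrix.sum_apply]
    rw [this]
    exact Matrix.posSemidef_sum _ fun z _ => hρ.1.submatrix _
  · rw [← mul_one (reduced k ρ), ← trace_mul_siteOp, siteOp_one, mul_one, hρ.2]

theorem norm_covariance_siteOp_le {k l : Fin N} (hkl : k ≠ l)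
    {ρ : Matrix (∀ l, d l) (∀ l, d l) ℂ} (hρ : IsDensityMatrix ρ)
    (A : Matrix (d k) (d k) ℂ) (B : Matrix (d l) (d l) ℂ) :
    ‖covariance ρ (siteOp k A) (siteOp l B)‖ ≤
      ‖A‖ * ‖B‖ * (2 * √(vonNeumannEntropy (reduced k ρ))) := by
  obtain ⟨P, ε, hP, hPs, hPρ, hα, hε, hs⟩ := exists_top_projection (isDensityMatrix_reduced k hρ)
  obtain ⟨α, hαP, hαn⟩ := hα A
  have hc : siteOp k (1 - P) = 1 - siteOp k P :=
    (map_sub (siteHom k) 1 P).trans (congrArg (· - siteOp k P) (siteOp_one k))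
  have hPc : P * (1 - P) = 0 := by rw [mul_sub, hP, mul_one, sub_self]
  have hcP : (1 - P) * P = 0 := by rw [sub_mul, hP, one_mul, sub_self]
  -- On the reduced state, cyclicity and commutation with `P` bring `1 - P` next to `P`.
  have h₁ : (ρ * (siteOp k P * siteOp k A * (1 - siteOp k P))).trace = 0 := by
    rw [← hc, ← siteOp_mul, ← siteOp_mul, trace_mul_siteOp, mul_assoc P, ← mul_assoc, ← hPρ,
      mul_assoc, Matrix.trace_mul_comm, mul_assoc, mul_assoc, hcP, mul_zero, mul_zero,
      Matrix.trace_zero]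
  have h₂ : (ρ * ((1 - siteOp k P) * siteOp k A * siteOp k P)).trace = 0 := by
    rw [← hc, ← siteOp_mul, ← siteOp_mul, trace_mul_siteOp, ← mul_assoc, Matrix.trace_mul_comm,
      ← mul_assoc, hPρ, mul_assoc, ← mul_assoc P, hPc, zero_mul, mul_zero, Matrix.trace_zero]
  have hproj := norm_covariance_le_of_projection hρ (P := siteOp k P)
    (by rw [← siteOp_mul, hP]) (by rw [← siteOp_conjTranspose, hPs]) (siteOp_commute hkl P B)
    (by rw [← siteOp_mul, ← siteOp_mul, hαP]; exact map_smul (siteHom k) α P)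
    (norm_siteOp_le k A) hαn h₁ h₂ (by rw [trace_mul_siteOp, hε])
  have htriv := (norm_covariance_le_mul hρ (siteOp k A) (siteOp l B)).trans
    (mul_le_mul_of_nonneg_right (norm_siteOp_le k A) (norm_nonneg _))
  calc ‖covariance ρ (siteOp k A) (siteOp l B)‖
      ≤ ‖A‖ * ‖siteOp l B‖ * min 1 (2 * √(ε * (1 - ε)) + 4 * ε) := by
        rcases min_choice 1 (2 * √(ε * (1 - ε)) + 4 * ε) with h | h <;> rw [h]
        · rwa [mul_one]
        · exact hproj
    _ ≤ ‖A‖ * ‖siteOp l B‖ * (2 * √(vonNeumannEntropy (reduced k ρ))) :=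
        mul_le_mul_of_nonneg_left hs (by positivity)
    _ ≤ _ := by gcongr; exact norm_siteOp_le l B

/-! ### Variance of the sum and averaging over sites. -/

theorem variance_sum_eq {n ι : Type*} [Fintype n] [Fintype ι] [DecidableEq n]
    {ρ : Matrix n n ℂ} (hρ : ρ.IsHermitian) (X : ι → Matrix n n ℂ) :
    variance ρ (∑ k, X k) = ∑ k, ∑ l, (covariance ρ (X k)ᴴ (X l)).re := by
  have h : variance ρ (∑ k, X k) = (covariance ρ (∑ k, X k)ᴴ (∑ k, X k)).re := by
    rw [variance, covariance, trace_star_apply hρ, Complex.star_def, Complex.conj_mul',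
      Complex.sub_re, ← Complex.ofReal_pow, Complex.ofReal_re]
  rw [h]
  simp only [← Complex.re_sum]
  congr 1
  simp only [covariance, Matrix.conjTranspose_sum, Matrix.mul_sum,
    Matrix.trace_sum, Finset.sum_mul_sum, Finset.sum_sub_distrib]

theorem re_covariance_self_le {n : Type*} [Fintype n] [DecidableEq n] {ρ : Matrix n n ℂ}
    (hρ : IsDensityMatrix ρ) (A : Matrix n n ℂ) : (covariance ρ Aᴴ A).re ≤ ‖A‖ ^ 2 := by
  refine (Complex.re_le_norm _).trans ((norm_covariance_le_mul hρ _ _).trans_eq ?_)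
  rw [Matrix.l2_opNorm_conjTranspose, sq]

theorem variance_sumSiteOp_le (G : ∀ k, Matrix (d k) (d k) ℂ)
    {ρ : Matrix (∀ k, d k) (∀ k, d k) ℂ} (hρ : IsDensityMatrix ρ) :
    variance ρ (sumSiteOp G) ≤ ∑ k, ‖G k‖ ^ 2 +
      2 * (∑ k, ‖G k‖ * √(vonNeumannEntropy (reduced k ρ))) * ∑ k, ‖G k‖ := by
  -- The nonnegative entropy term is kept also for `k = l`, so that its double sum factors.
  have hterm : ∀ k l, (covariance ρ (siteOp k (G k))ᴴ (siteOp l (G l))).re ≤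
      (if k = l then ‖G k‖ ^ 2 else 0) +
        2 * (‖G k‖ * √(vonNeumannEntropy (reduced k ρ))) * ‖G l‖ := by
    intro k l
    split_ifs with h
    · subst h
      have h1 := re_covariance_self_le hρ (siteOp k (G k))
      have h2 : ‖siteOp k (G k)‖ ^ 2 ≤ ‖G k‖ ^ 2 :=
        pow_le_pow_left₀ (norm_nonneg _) (norm_siteOp_le k (G k)) 2
      have h3 : 0 ≤ 2 * (‖G k‖ * √(vonNeumannEntropy (reduced k ρ))) * ‖G k‖ := by positivity
      linarith
    · have h1 := norm_covariance_siteOp_le h hρ (G k)ᴴ (G l)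
      rw [Matrix.l2_opNorm_conjTranspose, siteOp_conjTranspose] at h1
      refine (Complex.re_le_norm _).trans (h1.trans_eq (by ring))
  rw [sumSiteOp, variance_sum_eq hρ.1.isHermitian]
  refine (Finset.sum_le_sum fun k _ => Finset.sum_le_sum fun l _ => hterm k l).trans_eq ?_
  simp only [Finset.sum_add_distrib, Finset.sum_ite_eq, Finset.mem_univ, if_true,
    ← Finset.mul_sum, ← Finset.sum_mul]

theorem vonNeumannEntropy_nonneg {n : Type*} [Fintype n] [DecidableEq n] {ρ : Matrix n n ℂ}
    (hρ : IsDensityMatrix ρ) : 0 ≤ vonNeumannEntropy ρ := by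
  have hH := hρ.1.isHermitian
  have hsum : ∑ j, hH.eigenvalues j = 1 := by
    have := hH.trace_eq_sum_eigenvalues
    rw [hρ.2] at this
    exact Complex.ofReal_injective (by rw [Complex.ofReal_sum, Complex.ofReal_one]; exact this.symm)
  rw [vonNeumannEntropy_eq_sum hH]
  exact Finset.sum_nonneg fun j _ => Real.negMulLog_nonneg (hρ.1.eigenvalues_nonneg j)
    (hsum ▸ Finset.single_le_sum (fun k _ => hρ.1.eigenvalues_nonneg k) (Finset.mem_univ j))

/-- Cauchy–Schwarz bounds the squares of the two factors by `(∑ g²)(∑ s)` and `N ∑ g²`; passing to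
averages gives the power of `N`. -/
theorem sum_mul_sqrt_mul_sum_le {g s : Fin N → ℝ} (hg : ∀ k, 0 ≤ g k) (hs : ∀ k, 0 ≤ s k) :
    (∑ k, g k * √(s k)) * ∑ k, g k ≤ avg (fun k => g k ^ 2) * ((N : ℝ) ^ 2 * √(avg s)) := by
  rcases Nat.eq_zero_or_pos N with rfl | hN
  · simp [avg]
  have hN' : (0 : ℝ) < N := Nat.cast_pos.mpr hN
  have h1 : (∑ k, g k * √(s k)) ^ 2 ≤ (∑ k, g k ^ 2) * ∑ k, s k := by
    refine (Finset.sum_mul_sq_le_sq_mul_sq _ _ _).trans_eq ?_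
    simp only [Real.sq_sqrt (hs _)]
  have h2 : (∑ k, g k) ^ 2 ≤ N * ∑ k, g k ^ 2 := by
    simpa using sq_sum_le_card_mul_sum_sq (s := Finset.univ) (f := g)
  have hG : 0 ≤ ∑ k, g k ^ 2 := Finset.sum_nonneg fun k _ => sq_nonneg _
  have hS : 0 ≤ ∑ k, s k := Finset.sum_nonneg fun k _ => hs k
  have hR : 0 ≤ avg (fun k => g k ^ 2) * ((N : ℝ) ^ 2 * √(avg s)) := by
    rw [avg]; positivity
  refine abs_le_of_sq_le_sq' ?_ hR |>.2
  rw [mul_pow]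
  refine (mul_le_mul h1 h2 (sq_nonneg _) (mul_nonneg hG hS)).trans_eq ?_
  rw [mul_pow, mul_pow, Real.sq_sqrt (by rw [avg]; positivity), avg, avg]
  field_simp

end SiteOperators

end QuantumVariance

theorem mainTheorem1 {N : ℕ} {d : Fin N → Type*} [∀ k, Fintype (d k)] [∀ k, DecidableEq (d k)]
    (G : ∀ k, Matrix (d k) (d k) ℂ) (ρ : Matrix (∀ k, d k) (∀ k, d k) ℂ)
    (hρ : QuantumVariance.IsDensityMatrix ρ) :
    QuantumVariance.variance ρ (QuantumVariance.sumSiteOp G) ≤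
      QuantumVariance.avg (fun k => QuantumVariance.schattenInfNorm (G k) ^ 2) *
        ((N : ℝ) + 2 * (N : ℝ) ^ 2 *
          Real.sqrt (QuantumVariance.avg fun k =>
            QuantumVariance.vonNeumannEntropy (QuantumVariance.reduced k ρ))) := by
  -- `schattenInfNorm` is definitionally the L2 operator norm used above.
  have h1 : QuantumVariance.variance ρ (QuantumVariance.sumSiteOp G) ≤
      ∑ k, QuantumVariance.schattenInfNorm (G k) ^ 2 +
        2 * (∑ k, QuantumVariance.schattenInfNorm (G k) *
          √(QuantumVariance.vonNeumannEntropy (QuantumVariance.reduced k ρ))) *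
            ∑ k, QuantumVariance.schattenInfNorm (G k) :=
    QuantumVariance.variance_sumSiteOp_le G hρ
  have h2 := QuantumVariance.sum_mul_sqrt_mul_sum_le
    (g := fun k => QuantumVariance.schattenInfNorm (G k))
    (fun k => (norm_nonneg _ : 0 ≤ QuantumVariance.schattenInfNorm (G k)))
    (fun k => QuantumVariance.vonNeumannEntropy_nonneg
      (QuantumVariance.isDensityMatrix_reduced k hρ))
  have h3 : ∑ k, QuantumVariance.schattenInfNorm (G k) ^ 2 =
      QuantumVariance.avg (fun k => QuantumVariance.schattenInfNorm (G k) ^ 2) * N := by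
    rcases Nat.eq_zero_or_pos N with rfl | hN
    · simp
    · rw [QuantumVariance.avg, div_mul_cancel₀ _ (Nat.cast_ne_zero.mpr hN.ne')]
  rw [h3] at h1
  linarith
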